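/- Let $M$ be a compact (connected, boundaryless, smooth) Riemannian manifold of dimension $n\ge 0$, regarded as a metric space with its geodesic distance $d$, and let $r\ge 0$. An $r$-packing of $M$ is a subset $S\subseteq M$ with $d(x,y)\ge r$ for all distinct $x,y\in S$, and $p=\mathrm{pack}_M(r)\in\{0,1,2,\dots\}\cup\{\infty\}$ is the largest cardinality of an $r$-packing of $M$ (with $p=\infty$ if there are arbitrarily large ones; $p$ is finite when $r>0$). The anti-Vietoris--Rips metric thickening $\mathrm{AVR}^m(M;r)$ is the set of all finitely supported probability measures $\sum_{i=0}^{\ell}\lambda_i\delta_{x_i}$ on $M$ with $\ell\ge 0$, $\lambda_i>0$, $\sum_i\lambda_i=1$ and $d(x_i,x_j)\ge r$ for all $i\ne j$, with the topology of the $1$-Wasserstein distance $$W_1(\mu,\nu)=\inf_{\pi}\int_{M\times M} d(x,y)\,d\pi(x,y),$$ where $\pi$ ranges over the measures on $M\times M$ with marginals $\mu$ and $\nu$. For a topological space $X$ and an abelian group $G$, the Čech cohomology $\check H^k(X;G)$ is the direct limit, over all open covers $\mathcal U$ of $X$ ordered by refinement, of the simplicial cohomology groups $H^k(N(\mathcal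 U);G)$ of the nerves. Then, for every abelian group $G$, $\check H^k(\mathrm{AVR}^m(M;r);G)=0$ for every integer $k\ge (n+1)p$. -/

import Mathlib

open MeasureTheory Set Bundle
open scoped ENNReal NNReal Manifold ContDiff Topology

noncomputable section

/-! ### Packing number -/

/-- `S` is an `r`-packing of `X`: distinct points of `S` are at distance at least `r`. -/
def IsPacking {X : Type*} [MetricSpace X] (r : ℝ) (S : Set X) : Prop :=
  ∀ x ∈ S, ∀ y ∈ S, x ≠ y → r ≤ dist x y

/-- The packing number of `X` at scale `r`: the largest cardinality of an `r`-packing,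
with value `⊤` if there are arbitrarily large `r`-packings. -/
def packingNumber (X : Type*) [MetricSpace X] (r : ℝ) : ℕ∞ :=
  ⨆ (S : Set X) (_ : IsPacking r S), S.encard

/-! ### The 1-Wasserstein distance -/

/-- `γ` is a transport plan between `μ` and `ν`: a measure on the product with marginals `μ`, `ν`.
For finitely supported `μ` and `ν`, every such measure is finitely supported, hence Radon. -/
def IsTransportPlan {X : Type*} [MeasurableSpace X] (μ ν : Measure X) (γ : Measure (X × X)) :
    Prop :=
  γ.map Prod.fst = μ ∧ γ.map Prod.snd = ν

/-- The 1-Wasserstein distance (as an extended nonnegative real): the infimum of the costs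
`∫ d(x, y) dγ` of all transport plans `γ`. -/
def wassersteinEDist {X : Type*} [MetricSpace X] [MeasurableSpace X] (μ ν : Measure X) : ℝ≥0∞ :=
  ⨅ (γ : Measure (X × X)) (_ : IsTransportPlan μ ν γ), ∫⁻ z, edist z.1 z.2 ∂γ

lemma wassersteinEDist_self {X : Type*} [MetricSpace X] [MeasurableSpace X] (μ : Measure X) :
    wassersteinEDist μ μ = 0 := by
  have hm : Measurable (fun x : X => (x, x)) := measurable_id.prodMk measurable_id
  refine le_antisymm ?_ zero_le
  refine (iInf₂_le (μ.map fun x => (x, x)) ⟨?fst, ?snd⟩).trans ?cost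
  case fst =>
    rw [Measure.map_map measurable_fst hm]; exact Measure.map_id
  case snd =>
    rw [Measure.map_map measurable_snd hm]; exact Measure.map_id
  case cost =>
    exact (lintegral_map_le _ _).trans (by simp)

lemma wassersteinEDist_comm_le {X : Type*} [MetricSpace X] [MeasurableSpace X]
    (μ ν : Measure X) : wassersteinEDist μ ν ≤ wassersteinEDist ν μ := by
  refine le_iInf₂ fun γ hγ => (iInf₂_le (γ.map Prod.swap) ⟨?fst, ?snd⟩).trans ?cost
  case fst =>
    rw [Measure.map_map measurable_fst measurable_swap]; exact hγ.2
  case snd =>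
    rw [Measure.map_map measurable_snd measurable_swap]; exact hγ.1
  case cost =>
    refine (lintegral_map_le _ _).trans (le_of_eq ?_)
    simp [edist_comm]

lemma sum_restrict_fiber {X Z : Type*} [MeasurableSpace X] [MeasurableSingletonClass X]
    [MeasurableSpace Z] (γ : Measure Z) {f : Z → X} (hf : Measurable f) (s : Finset X)
    (hs : γ.map f (s : Set X)ᶜ = 0) : ∑ y ∈ s, γ.restrict (f ⁻¹' {y}) = γ := by
  classical
  ext A hA
  rw [Measure.map_apply hf s.measurableSet.compl] at hs
  have h1 : ∀ y ∈ s, γ.restrict (f ⁻¹' {y}) A = γ (A ∩ f ⁻¹' {y}) := fun y _ =>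
    Measure.restrict_apply hA
  rw [Measure.finsetSum_apply, Finset.sum_congr rfl h1, ← measure_biUnion_finset]
  · refine measure_congr ?_
    have : ∀ᵐ z ∂γ, f z ∈ s := by
      rw [ae_iff]; exact hs
    filter_upwards [this] with z hz
    apply propext
    change (z ∈ ⋃ y ∈ s, A ∩ f ⁻¹' {y}) ↔ z ∈ A
    simp only [mem_iUnion, mem_inter_iff, mem_preimage, mem_singleton_iff]
    exact ⟨fun ⟨_, _, h, _⟩ => h, fun h => ⟨f z, hz, h, rfl⟩⟩
  · intro y _ y' _ hyy'
    refine Set.disjoint_left.2 fun z hz hz' => hyy' ?_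
    exact hz.2.symm.trans hz'.2
  · exact fun y _ => hA.inter (hf (measurableSet_singleton y))

/-- The triangle inequality when the middle measure is finite and finitely supported, by
gluing transport plans along the atoms of the middle measure. -/
lemma wassersteinEDist_triangle {X : Type*} [MetricSpace X] [MeasurableSpace X] [BorelSpace X]
    (μ ν ρ : Measure X) [IsFiniteMeasure ν] (s : Finset X) (hs : ν (s : Set X)ᶜ = 0) :
    wassersteinEDist μ ρ ≤ wassersteinEDist μ ν + wassersteinEDist ν ρ := by
  classical
  unfold wassersteinEDist
  simp_rw [ENNReal.iInf_add, ENNReal.add_iInf]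
  refine le_iInf₂ fun γ hγ => le_iInf₂ fun σ hσ => ?_
  set α : X → Measure X := fun y => (γ.restrict (Prod.snd ⁻¹' {y})).map Prod.fst with hα
  set β : X → Measure X := fun y => (σ.restrict (Prod.fst ⁻¹' {y})).map Prod.snd with hβ
  have hαu : ∀ y, α y univ = ν {y} := fun y => by
    rw [hα, ← hγ.2]
    simp only
    rw [Measure.map_apply measurable_fst .univ, preimage_univ, Measure.restrict_apply .univ,
      univ_inter, Measure.map_apply measurable_snd (measurableSet_singleton y)]
  have hβu : ∀ y, β y univ = ν {y} := fun y => by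
    rw [hβ, ← hσ.1]
    simp only
    rw [Measure.map_apply measurable_snd .univ, preimage_univ, Measure.restrict_apply .univ,
      univ_inter, Measure.map_apply measurable_fst (measurableSet_singleton y)]
  have hfα : ∀ y, IsFiniteMeasure (α y) := fun y => ⟨by rw [hαu]; exact measure_lt_top _ _⟩
  have hfβ : ∀ y, IsFiniteMeasure (β y) := fun y => ⟨by rw [hβu]; exact measure_lt_top _ _⟩
  have hsα : ∑ y ∈ s, α y = μ := by
    rw [← hγ.1]
    conv_rhs => rw [← sum_restrict_fiber γ measurable_snd s (by rw [hγ.2]; exact hs)]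
    rw [← Measure.mapₗ_apply_of_measurable measurable_fst, map_sum]
    exact Finset.sum_congr rfl fun y _ =>
      (Measure.mapₗ_apply_of_measurable measurable_fst _).symm
  have hsβ : ∑ y ∈ s, β y = ρ := by
    rw [← hσ.2]
    conv_rhs => rw [← sum_restrict_fiber σ measurable_fst s (by rw [hσ.1]; exact hs)]
    rw [← Measure.mapₗ_apply_of_measurable measurable_snd, map_sum]
    exact Finset.sum_congr rfl fun y _ =>
      (Measure.mapₗ_apply_of_measurable measurable_snd _).symm
  have key : ∀ (τ : Measure X) (y : X), τ univ = ν {y} → (ν {y})⁻¹ • (ν {y} • τ) = τ := by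
    intro τ y hτ
    rcases eq_or_ne (ν {y}) 0 with h0 | h0
    · rw [h0, Measure.measure_univ_eq_zero] at hτ
      simp [hτ]
    · rw [smul_smul, ENNReal.inv_mul_cancel h0 (measure_ne_top _ _), one_smul]
  have m1 : ∀ y, (ν {y})⁻¹ • ((α y).prod (β y)).map Prod.fst = α y := fun y => by
    rw [Measure.map_fst_prod, hβu]; exact key _ _ (hαu y)
  have m2 : ∀ y, (ν {y})⁻¹ • ((α y).prod (β y)).map Prod.snd = β y := fun y => by
    rw [Measure.map_snd_prod, hαu]; exact key _ _ (hβu y)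
  refine (iInf₂_le (∑ y ∈ s, (ν {y})⁻¹ • (α y).prod (β y)) ⟨?fst, ?snd⟩).trans ?cost
  case fst =>
    rw [← Measure.mapₗ_apply_of_measurable measurable_fst, map_sum, ← hsα]
    refine Finset.sum_congr rfl fun y _ => ?_
    rw [Measure.mapₗ_apply_of_measurable measurable_fst, Measure.map_smul, m1]
  case snd =>
    rw [← Measure.mapₗ_apply_of_measurable measurable_snd, map_sum, ← hsβ]
    refine Finset.sum_congr rfl fun y _ => ?_
    rw [Measure.mapₗ_apply_of_measurable measurable_snd, Measure.map_smul, m2]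
  case cost =>
    have c1 : ∑ y ∈ s, ∫⁻ x, edist x y ∂(α y) ≤ ∫⁻ z, edist z.1 z.2 ∂γ := by
      conv_rhs => rw [← sum_restrict_fiber γ measurable_snd s (by rw [hγ.2]; exact hs)]
      rw [lintegral_finsetSum_measure]
      refine Finset.sum_le_sum fun y _ => (lintegral_map_le _ _).trans (le_of_eq ?_)
      refine setLIntegral_congr_fun (measurable_snd (measurableSet_singleton y)) ?_
      intro z hz
      have : z.2 = y := hz
      simp [this]
    have c2 : ∑ y ∈ s, ∫⁻ x, edist y x ∂(β y) ≤ ∫⁻ z, edist z.1 z.2 ∂σ := by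
      conv_rhs => rw [← sum_restrict_fiber σ measurable_fst s (by rw [hσ.1]; exact hs)]
      rw [lintegral_finsetSum_measure]
      refine Finset.sum_le_sum fun y _ => (lintegral_map_le _ _).trans (le_of_eq ?_)
      refine setLIntegral_congr_fun (measurable_fst (measurableSet_singleton y)) ?_
      intro z hz
      have : z.1 = y := hz
      simp [this]
    refine le_trans ?_ (add_le_add c1 c2)
    rw [lintegral_finsetSum_measure, ← Finset.sum_add_distrib]
    refine Finset.sum_le_sum fun y _ => ?_
    have e1 : Measurable fun x : X => edist x y := measurable_edist_left
    have e2 : Measurable fun x : X => edist y x := measurable_edist_right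
    calc ∫⁻ z, edist z.1 z.2 ∂((ν {y})⁻¹ • (α y).prod (β y))
        ≤ ∫⁻ z, (edist z.1 y + edist y z.2) ∂((ν {y})⁻¹ • (α y).prod (β y)) :=
          lintegral_mono fun z => edist_triangle _ _ _
      _ = ∫⁻ x, edist x y ∂(α y) + ∫⁻ x, edist y x ∂(β y) := by
          have f1 : Measurable fun z : X × X => edist z.1 y := e1.comp measurable_fst
          have i1 := congrArg (fun τ => ∫⁻ x, edist x y ∂τ) (m1 y)
          have i2 := congrArg (fun τ => ∫⁻ x, edist y x ∂τ) (m2 y)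
          simp only [← Measure.map_smul] at i1 i2
          rw [lintegral_map e1 measurable_fst] at i1
          rw [lintegral_map e2 measurable_snd] at i2
          rw [lintegral_add_left f1, i1, i2]

/-! ### The anti-Vietoris--Rips metric thickening -/

/-- `μ` is a finitely supported probability measure `∑ λᵢ δ_{xᵢ}` (with `λᵢ > 0`, `∑ λᵢ = 1`)
whose support has spread at least `r`, i.e. is an `r`-packing. -/
def IsAntiVRMeasure {X : Type*} [MetricSpace X] [MeasurableSpace X] (r : ℝ) (μ : Measure X) :
    Prop :=
  ∃ (s : Finset X) (w : X → ℝ≥0), (∀ x ∈ s, 0 < w x) ∧ ∑ x ∈ s, w x = 1 ∧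
    IsPacking r (s : Set X) ∧ μ = ∑ x ∈ s, (w x : ℝ≥0∞) • Measure.dirac x

lemma IsAntiVRMeasure.exists_finset {X : Type*} [MetricSpace X] [MeasurableSpace X] [BorelSpace X]
    {r : ℝ} {μ : Measure X} (h : IsAntiVRMeasure r μ) :
    IsFiniteMeasure μ ∧ ∃ s : Finset X, μ (s : Set X)ᶜ = 0 := by
  obtain ⟨s, w, -, hw, -, rfl⟩ := h
  refine ⟨⟨?_⟩, s, ?_⟩
  · simp [Measure.finsetSum_apply, ENNReal.sum_lt_top]
  · rw [Measure.finsetSum_apply]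
    refine Finset.sum_eq_zero fun x hx => ?_
    rw [Measure.smul_apply, Measure.dirac_apply' _ s.measurableSet.compl]
    simp [hx]

/-- The underlying set of the anti-Vietoris--Rips metric thickening of `X` at scale `r`. -/
def AntiVRThickening (X : Type*) [MetricSpace X] [MeasurableSpace X] (r : ℝ) : Type _ :=
  {μ : Measure X // IsAntiVRMeasure r μ}

/-- The anti-Vietoris--Rips metric thickening carries the 1-Wasserstein distance, and the
topology induced by it. -/
instance AntiVRThickening.instPseudoEMetricSpace (X : Type*) [MetricSpace X] [MeasurableSpace X]
    [BorelSpace X] (r : ℝ) : PseudoEMetricSpace (AntiVRThickening X r) where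
  edist μ ν := wassersteinEDist μ.1 ν.1
  edist_self μ := wassersteinEDist_self μ.1
  edist_comm μ ν := le_antisymm (wassersteinEDist_comm_le _ _) (wassersteinEDist_comm_le _ _)
  edist_triangle μ ν ρ := by
    obtain ⟨h, s, hs⟩ := ν.2.exists_finset
    exact wassersteinEDist_triangle μ.1 ν.1 ρ.1 s hs

/-! ### Čech cohomology -/

/-- An open cover of the topological space `X`. -/
structure CechCover (X : Type*) [TopologicalSpace X] where
  /-- the members of the cover -/
  sets : Set (Set X)
  isOpen : ∀ A ∈ sets, IsOpen A
  sUnion_eq : ⋃₀ sets = univ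

namespace CechCover

variable {X : Type*} [TopologicalSpace X]

/-- Ordered `k`-simplices (possibly degenerate) of the nerve of `U`: the `(k+1)`-tuples of
members of `U` with nonempty common intersection. -/
abbrev Simplex (U : CechCover X) (k : ℕ) : Type _ :=
  {σ : Fin (k + 1) → U.sets // (⋂ i, (σ i : Set X)).Nonempty}

/-- Reindexing of the vertices of a simplex of the nerve; for `φ = i.succAbove` this is the face
opposite to the `i`-th vertex. -/
def Simplex.reindex {U : CechCover X} {k l : ℕ} (σ : U.Simplex k) (φ : Fin (l + 1) → Fin (k + 1)) :
    U.Simplex l :=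
  ⟨σ.1 ∘ φ, σ.2.mono fun _ hx => mem_iInter.2 fun i => mem_iInter.1 hx (φ i)⟩

/-- A refinement projection from `V` to `U`: a choice, for each member of `V`, of a member of `U`
containing it. One exists if and only if `V` refines `U`. -/
structure Refinement (V U : CechCover X) where
  toFun : V.sets → U.sets
  subset : ∀ A : V.sets, (A : Set X) ⊆ toFun A

/-- The simplicial map of nerves induced by a refinement projection. -/
def Simplex.push {V U : CechCover X} {k : ℕ} (ρ : V.Refinement U) (σ : V.Simplex k) :
    U.Simplex k :=
  ⟨ρ.toFun ∘ σ.1, σ.2.mono fun _ hx => mem_iInter.2 fun i => ρ.subset _ (mem_iInter.1 hx i)⟩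

/-- The simplicial `k`-cochains of the nerve of `U` with coefficients in `G`: functions on
ordered simplices that are alternating and vanish on degenerate simplices. -/
def cochains (U : CechCover X) (G : Type*) [AddCommGroup G] (k : ℕ) :
    AddSubgroup (U.Simplex k → G) where
  carrier := {f | (∀ (σ : U.Simplex k) (p : Equiv.Perm (Fin (k + 1))),
      f (σ.reindex p) = (Equiv.Perm.sign p : ℤ) • f σ) ∧
    ∀ σ : U.Simplex k, ¬ Function.Injective σ.1 → f σ = 0}
  add_mem' := by
    rintro f g ⟨hf, hf'⟩ ⟨hg, hg'⟩
    exact ⟨fun σ p => by simp only [Pi.add_apply, hf, hg, smul_add],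
      fun σ h => by simp only [Pi.add_apply, hf' σ h, hg' σ h, add_zero]⟩
  zero_mem' := ⟨fun σ p => by simp, fun σ h => rfl⟩
  neg_mem' := by
    rintro f ⟨hf, hf'⟩
    exact ⟨fun σ p => by simp only [Pi.neg_apply, hf, smul_neg],
      fun σ h => by simp only [Pi.neg_apply, hf' σ h, neg_zero]⟩

lemma exists_perm_succAbove {n : ℕ} (p : Equiv.Perm (Fin (n + 1))) (i : Fin (n + 1)) :
    ∃ q : Equiv.Perm (Fin n), (∀ j, p (i.succAbove j) = (p i).succAbove (q j)) ∧
      (Equiv.Perm.sign q : ℤ) = Equiv.Perm.sign p * ((-1) ^ (i : ℕ) * (-1) ^ ((p i : Fin _) : ℕ)) := by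
  set τ : Equiv.Perm (Fin (n + 1)) := (p i).cycleRange * p * i.cycleRange⁻¹ with hτ
  have h0 : τ 0 = 0 := by
    simp [hτ, Equiv.Perm.mul_apply, Equiv.Perm.inv_def, Fin.cycleRange_symm_zero]
  obtain ⟨⟨a, q⟩, ha⟩ := Equiv.Perm.decomposeFin.symm.surjective τ
  have ha0 : a = 0 := by
    rw [← h0, ← ha, Equiv.Perm.decomposeFin_symm_apply_zero]
  subst ha0
  refine ⟨q, fun j => ?_, ?_⟩
  · have h1 : τ j.succ = (q j).succ := by
      rw [← ha, Equiv.Perm.decomposeFin_symm_apply_succ]; simp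
    have h2 : τ j.succ = (p i).cycleRange (p (i.succAbove j)) := by
      simp [hτ, Equiv.Perm.mul_apply, Equiv.Perm.inv_def, Fin.cycleRange_symm_succ]
    apply (p i).cycleRange.injective
    rw [← h2, h1, Fin.cycleRange_succAbove]
  · have h1 : Equiv.Perm.sign τ = Equiv.Perm.sign q := by
      rw [← ha, Equiv.Perm.decomposeFin.symm_sign]; simp
    rw [← h1, hτ]
    simp only [map_mul, map_inv, Fin.sign_cycleRange]
    simp only [Units.val_mul, Units.val_pow_eq_pow_val, Int.units_inv_eq_self, Units.val_neg,
      Units.val_one]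
    ring

/-- The simplicial coboundary of the nerve, `(d f)(σ) = ∑ᵢ (-1)ⁱ f(∂ᵢ σ)`. -/
def coboundary (U : CechCover X) (G : Type*) [AddCommGroup G] (k : ℕ) :
    U.cochains G k →+ U.cochains G (k + 1) where
  toFun f := ⟨fun σ => ∑ i : Fin (k + 2), (-1 : ℤ) ^ (i : ℕ) • f.1 (σ.reindex i.succAbove), by
    obtain ⟨f, hf, hf'⟩ := f
    refine ⟨fun σ p => ?_, fun σ hσ => ?_⟩
    · choose q hq hs using exists_perm_succAbove p
      rw [Finset.smul_sum, ← Equiv.sum_comp p]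
      refine Finset.sum_congr rfl fun i _ => ?_
      have h : (σ.reindex p).reindex i.succAbove
          = (σ.reindex (p i).succAbove).reindex (q i) :=
        Subtype.ext (funext fun j => congrArg σ.1 (hq i j))
      simp only [h, hf, hs, smul_smul]
      congr 1
      rcases neg_one_pow_eq_or ℤ (i : ℕ) with h | h <;> simp [h, mul_comm]
    · obtain ⟨a, b, hab, hne⟩ : ∃ a b, σ.1 a = σ.1 b ∧ a ≠ b := by
        simpa [Function.Injective] using hσ
      obtain ⟨q, hq, hs⟩ := exists_perm_succAbove (Equiv.swap a b) a
      have h : σ.reindex a.succAbove = (σ.reindex b.succAbove).reindex q := by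
        refine Subtype.ext (funext fun j => ?_)
        have := hq j
        rw [Equiv.swap_apply_left] at this
        change σ.1 (a.succAbove j) = σ.1 (b.succAbove (q j))
        rw [← this]
        by_cases hj : a.succAbove j = b
        · rw [hj, Equiv.swap_apply_right, hab]
        · rw [Equiv.swap_apply_of_ne_of_ne (Fin.succAbove_ne a j) hj]
      change ∑ i : Fin (k + 2), (-1 : ℤ) ^ (i : ℕ) • f (σ.reindex i.succAbove) = 0
      rw [Finset.sum_eq_add a b hne]
      · simp only [h, hf, hs, smul_smul, Equiv.swap_apply_left, Equiv.Perm.sign_swap hne]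
        rw [← add_smul]
        rcases neg_one_pow_eq_or ℤ (a : ℕ) with h | h <;> simp [h]
      · rintro c - ⟨hca, hcb⟩
        obtain ⟨a', ha'⟩ := Fin.exists_succAbove_eq hca.symm
        obtain ⟨b', hb'⟩ := Fin.exists_succAbove_eq hcb.symm
        rw [hf', smul_zero]
        intro hinj
        have : a' = b' := hinj (by
          change σ.1 (c.succAbove a') = σ.1 (c.succAbove b')
          rw [ha', hb', hab])
        exact hne (by rw [← ha', ← hb', this])
      · simp
      · simp⟩
  map_zero' := by
    refine Subtype.ext (funext fun σ => ?_)
    simp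
  map_add' f g := by
    refine Subtype.ext (funext fun σ => ?_)
    simp [smul_add, Finset.sum_add_distrib]

lemma coboundary_coboundary (U : CechCover X) (G : Type*) [AddCommGroup G] (k : ℕ)
    (f : U.cochains G k) : U.coboundary G (k+1) (U.coboundary G k f) = 0 := by
  refine Subtype.ext (funext fun σ => ?_)
  change ∑ i : Fin (k + 3), (-1 : ℤ) ^ (i : ℕ) •
    ∑ j : Fin (k + 2), (-1 : ℤ) ^ (j : ℕ) • f.1 ((σ.reindex i.succAbove).reindex j.succAbove) = 0
  simp only [Finset.smul_sum, smul_smul]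
  rw [← Finset.sum_product']
  refine Finset.sum_involution (fun p _ => (p.1.succAbove p.2, p.2.predAbove p.1)) ?_ ?_ ?_ ?_
  · rintro ⟨i, j⟩ -
    have : ((Simplex.reindex σ i.succAbove).reindex j.succAbove) =
        ((Simplex.reindex σ (i.succAbove j).succAbove).reindex (j.predAbove i).succAbove) := by
      refine Subtype.ext (funext fun l => congrArg σ.1 ?_)
      exact (Fin.succAbove_succAbove_succAbove_predAbove _ _ _).symm
    simp only [this, ← add_smul]
    simp only [← pow_add, Fin.neg_one_pow_succAbove_add_predAbove]
    simp
  · rintro ⟨i, j⟩ - _ h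
    exact Fin.succAbove_ne _ _ (congrArg Prod.fst h)
  · simp
  · rintro ⟨i, j⟩ -
    simp [Fin.succAbove_succAbove_predAbove, Fin.predAbove_predAbove_succAbove]

/-- The `k`-cocycles of the nerve of `U`. -/
def cocycles (U : CechCover X) (G : Type*) [AddCommGroup G] (k : ℕ) :
    AddSubgroup (U.cochains G k) :=
  (U.coboundary G k).ker

/-- The `k`-coboundaries of the nerve of `U`. -/
def coboundaries (U : CechCover X) (G : Type*) [AddCommGroup G] :
    ∀ k : ℕ, AddSubgroup (U.cochains G k)
  | 0 => ⊥
  | k + 1 => (U.coboundary G k).range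

/-- The simplicial cohomology `H^k(N(U); G)` of the nerve of `U`: cocycles modulo
coboundaries. -/
abbrev NerveCohomology (U : CechCover X) (G : Type*) [AddCommGroup G] (k : ℕ) : Type _ :=
  U.cocycles G k ⧸ (U.coboundaries G k).addSubgroupOf (U.cocycles G k)

/-- Pullback of cochains along the map of nerves given by a refinement projection. -/
def Refinement.pullCochain {V U : CechCover X} (ρ : V.Refinement U) (G : Type*) [AddCommGroup G]
    (k : ℕ) : U.cochains G k →+ V.cochains G k where
  toFun f := ⟨fun σ => f.1 (σ.push ρ), fun σ p => f.2.1 (σ.push ρ) p, fun σ hσ => by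
    refine f.2.2 _ fun h => hσ ?_
    exact Function.Injective.of_comp (f := ρ.toFun) h⟩
  map_zero' := rfl
  map_add' _ _ := rfl

lemma Refinement.pullCochain_coboundary {V U : CechCover X} (ρ : V.Refinement U) (G : Type*)
    [AddCommGroup G] (k : ℕ) (f : U.cochains G k) :
    ρ.pullCochain G (k + 1) (U.coboundary G k f) = V.coboundary G k (ρ.pullCochain G k f) :=
  rfl

/-- Pullback of cocycles along a refinement projection. -/
def Refinement.pullCocycle {V U : CechCover X} (ρ : V.Refinement U) (G : Type*) [AddCommGroup G]
    (k : ℕ) : U.cocycles G k →+ V.cocycles G k :=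
  ((ρ.pullCochain G k).comp (U.cocycles G k).subtype).codRestrict (V.cocycles G k) fun f => by
    have hf : U.coboundary G k f.1 = 0 := f.2
    change V.coboundary G k (ρ.pullCochain G k f.1) = 0
    rw [← ρ.pullCochain_coboundary, hf, map_zero]

/-- The map `H^k(N(U); G) → H^k(N(V); G)` induced by a refinement projection from `V` to `U`. -/
def Refinement.pullCohomology {V U : CechCover X} (ρ : V.Refinement U) (G : Type*)
    [AddCommGroup G] (k : ℕ) : U.NerveCohomology G k →+ V.NerveCohomology G k :=
  QuotientAddGroup.map _ _ (ρ.pullCocycle G k) (by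
    rintro ⟨f, hf⟩ h
    cases k with
    | zero =>
      have h : f = 0 := h
      subst h
      change ρ.pullCochain G 0 0 ∈ (⊥ : AddSubgroup _)
      simp
    | succ k =>
      obtain ⟨g, hg⟩ := (h : f ∈ (U.coboundary G k).range)
      change ρ.pullCochain G (k + 1) f ∈ (V.coboundary G k).range
      exact ⟨ρ.pullCochain G k g, by rw [← ρ.pullCochain_coboundary, hg]; rfl⟩)

end CechCover

open scoped Classical in
/-- The relations identifying, in the direct sum of the groups `H^k(N(U); G)` over all open covers
`U`, each class with its pullbacks along all refinement projections. -/
def cechRelations (X : Type*) [TopologicalSpace X] (G : Type*) [AddCommGroup G] (k : ℕ) :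
    AddSubgroup (DirectSum (CechCover X) fun U => U.NerveCohomology G k) :=
  AddSubgroup.closure
    {z | ∃ (U V : CechCover X) (ρ : V.Refinement U) (c : U.NerveCohomology G k),
      z = DirectSum.of (fun W : CechCover X => W.NerveCohomology G k) V (ρ.pullCohomology G k c) -
        DirectSum.of (fun W : CechCover X => W.NerveCohomology G k) U c}

/-- The Čech cohomology `Ȟ^k(X; G)`: the direct limit, over all open covers `U` of `X` ordered by
refinement, of the simplicial cohomology groups of the nerves, presented as the quotient of the
direct sum by the identifications along refinements. -/
def CechCohomology (X : Type*) [TopologicalSpace X] (G : Type*) [AddCommGroup G] (k : ℕ) :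
    Type _ :=
  DirectSum (CechCover X) (fun U => U.NerveCohomology G k) ⧸ cechRelations X G k

instance (X : Type*) [TopologicalSpace X] (G : Type*) [AddCommGroup G] (k : ℕ) :
    AddCommGroup (CechCohomology X G k) :=
  inferInstanceAs (AddCommGroup
    (DirectSum (CechCover X) (fun U => U.NerveCohomology G k) ⧸ cechRelations X G k))

end

/-! Let `p` be the packing number. If it is infinite the degree hypothesis cannot hold, and if it is
zero the thickening is empty. Otherwise every measure in the thickening is a weighted sum of at most
`p` Dirac masses, so the thickening is the image of a closed subset of `M ^ p × Δ ^ (p - 1)` under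
`(x, l) ↦ ∑ i, l i • δ_{x i}`. This map is Lipschitz for the Wasserstein distance
(`exists_lipschitzWith_antiVRParametrization`). Its source has Hausdorff dimension at most `n p + (p
- 1) = (n + 1) p - 1`, since charts of `M` have locally Lipschitz inverses
(`exists_lipschitzOnWith_extChartAt_symm`, `dimH_pi_prod_stdSimplex_le`). Hence the thickening is
compact and all its Lipschitz images have dimension less than `k`.

The rest is the classical comparison of covering dimension with Hausdorff dimension
(`CechCohomology.subsingleton_of_dimH_lt`). A finite open cover has a Lipschitz family of bump
functions, hence a map to a simplex with image of dimension less than `k`. That image misses a point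
of every open `k`-face, so radial projection pushes it into the `(k - 1)`-skeleton
(`exists_push_to_skeleton`). Pulling back the open stars of the vertices refines the cover so that
no `k + 1` distinct members meet. The nerve of the refinement has no nonzero alternating
`k`-cochains. -/

/-! ### Inverse charts of a Riemannian manifold are locally Lipschitz. -/

section ChartLipschitz

open Metric

attribute [local instance] normedAddCommGroupTangentSpaceVectorSpace
attribute [local instance] normedSpaceTangentSpaceVectorSpace

variable {E : Type*} [NormedAddCommGroup E] [NormedSpace ℝ E]
  {H : Type*} [TopologicalSpace H] {I : ModelWithCorners ℝ E H}
  {M : Type*} [PseudoEMetricSpace M] [ChartedSpace H M]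
  [RiemannianBundle (fun x : M => TangentSpace I x)]
  [IsManifold I 1 M] [IsContinuousRiemannianBundle E (fun x : M => TangentSpace I x)]

theorem eventually_enorm_mfderivWithin_symm_extChartAt_le (x : M) :
    ∃ C : ℝ≥0, ∀ᶠ y in 𝓝[range I] (extChartAt I x x), ∀ v : TangentSpace 𝓘(ℝ, E) y,
      ‖mfderiv[range I] (extChartAt I x).symm y v‖ₑ ≤ C * ‖v‖ₑ := by
  obtain ⟨C, -, hC⟩ := eventually_enorm_mfderivWithin_symm_extChartAt_lt I x
  refine ⟨C, hC.mono fun y hy v => ?_⟩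
  exact (ContinuousLinearMap.le_opENorm _ _).trans (mul_le_mul_left hy.le _)

/-- On a Riemannian manifold, the inverse of the chart at `x` is Lipschitz near the image
of `x`. -/
theorem exists_lipschitzOnWith_extChartAt_symm [IsRiemannianManifold I M] (x : M) :
    ∃ C : ℝ≥0, ∃ t ∈ 𝓝[range I] (extChartAt I x x), t ⊆ (extChartAt I x).target ∧
      LipschitzOnWith C (extChartAt I x).symm t := by
  rcases eventually_enorm_mfderivWithin_symm_extChartAt_le (I := I) x with ⟨C, hC⟩
  obtain ⟨r, r_pos, hr⟩ : ∃ r > 0,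
      ball (extChartAt I x x) r ∩ range I ⊆ (extChartAt I x).target ∩
        {y | ∀ v : TangentSpace 𝓘(ℝ, E) y, ‖mfderiv[range I] (extChartAt I x).symm y v‖ₑ ≤ C * ‖v‖ₑ} :=
    mem_nhdsWithin_iff.1 (Filter.inter_mem (extChartAt_target_mem_nhdsWithin x) hC)
  refine ⟨C, ball (extChartAt I x x) r ∩ range I, ?_, fun y hy => (hr hy).1, ?_⟩
  · rw [inter_comm]
    exact inter_mem_nhdsWithin _ (ball_mem_nhds _ r_pos)
  intro u hu v hv
  -- The set `ball ∩ range I` is convex, so the segment from `u` to `v` stays where the derivative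
  -- bound holds. Its image is a path of length at most `C * edist u v`, which bounds the Riemannian
  -- distance.
  let η := ContinuousAffineMap.lineMap (R := ℝ) u v
  set γ := (extChartAt I x).symm ∘ η with hγ
  have hη : Icc 0 1 ⊆ ⇑η ⁻¹' ((extChartAt I x).target ∩
        {y | ∀ v : TangentSpace 𝓘(ℝ, E) y, ‖mfderiv[range I] (extChartAt I x).symm y v‖ₑ ≤ C * ‖v‖ₑ}) := by
    simp only [← image_subset_iff, ContinuousAffineMap.coe_lineMap_eq,
     ← segment_eq_image_lineMap, η]
    apply Subset.trans _ hr
    exact ((convex_ball _ _).inter I.convex_range).segment_subset hu hv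
  simp only [preimage_inter, subset_inter_iff] at hη
  have η_smooth : CMDiff[Icc 0 1] 1 η := by
    apply ContMDiff.contMDiffOn
    rw [contMDiff_iff_contDiff]
    exact ContinuousAffineMap.contDiff _
  rw [IsRiemannianManifold.out (I := I)]
  have : Manifold.riemannianEDist I ((extChartAt I x).symm u) ((extChartAt I x).symm v)
      ≤ Manifold.pathELength I γ 0 1 := by
    apply Manifold.riemannianEDist_le_pathELength _ _ _ zero_le_one
    · exact (contMDiffOn_extChartAt_symm x).comp η_smooth hη.1
    · simp [γ, η, ContinuousAffineMap.coe_lineMap_eq]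
    · simp [γ, η, ContinuousAffineMap.coe_lineMap_eq]
  apply this.trans
  rw [← lintegral_fderiv_lineMap_eq_edist, Manifold.pathELength_eq_lintegral_mfderivWithin_Icc,
    ← lintegral_const_mul' _ _ ENNReal.coe_ne_top]
  apply setLIntegral_mono' measurableSet_Icc (fun t ht ↦ ?_)
  have : mfderiv[Icc 0 1] γ t =
      (mfderiv[range I] (extChartAt I x).symm (η t)) ∘L (mfderiv[Icc 0 1] η t) := by
    apply mfderivWithin_comp
    · exact mdifferentiableWithinAt_extChartAt_symm (hη.1 ht)
    · exact η_smooth.mdifferentiableOn one_ne_zero t ht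
    · exact hη.1.trans (preimage_mono (extChartAt_target_subset_range x))
    · rw [uniqueMDiffWithinAt_iff_uniqueDiffWithinAt]
      exact uniqueDiffOn_Icc zero_lt_one t ht
  have : mfderiv[Icc 0 1] γ t 1 =
      (mfderiv[range I] (extChartAt I x).symm (η t)) (mfderiv[Icc 0 1] η t 1) := congr($this 1)
  rw [this]
  refine (hη.2 ht _).trans (le_of_eq ?_)
  simp only [mfderivWithin_eq_fderivWithin]
  rfl

end ChartLipschitz

/-! ### Vanishing of Čech cohomology from refinements of small order. -/

section Cech

/-- If every open cover has a refinement in which no `k + 1` distinct members meet, then Čech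
cohomology in degree `k` vanishes. -/
theorem CechCohomology.subsingleton_of_refinement {X : Type*} [TopologicalSpace X]
    (G : Type*) [AddCommGroup G] (k : ℕ)
    (h : ∀ U : CechCover X, ∃ V : CechCover X, Nonempty (V.Refinement U) ∧
      ∀ σ : V.Simplex k, ¬ Function.Injective σ.1) :
    Subsingleton (CechCohomology X G k) := by
  classical
  have key : ∀ z : DirectSum (CechCover X) (fun U => U.NerveCohomology G k),
      z ∈ cechRelations X G k := by
    intro z
    induction z using DirectSum.induction_on with
    | zero => exact zero_mem _
    | add x y hx hy => exact add_mem hx hy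
    | of U c =>
      obtain ⟨V, ⟨ρ⟩, hV⟩ := h U
      have h0 : ∀ f : V.cochains G k, f = 0 := fun f =>
        Subtype.ext (funext fun σ => f.2.2 σ (hV σ))
      have h1 : ρ.pullCohomology G k c = 0 := by
        obtain ⟨f, hf⟩ := QuotientAddGroup.mk_surjective (ρ.pullCohomology G k c)
        rw [← hf, show f = 0 from Subtype.ext (h0 _)]
        rfl
      -- The class of `c` is identified with its pullback to `V`, which is zero.
      have h2 := AddSubgroup.subset_closure (k := {z | ∃ (U V : CechCover X) (ρ : V.Refinement U)
        (c : U.NerveCohomology G k),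
        z = DirectSum.of (fun W : CechCover X => W.NerveCohomology G k) V
            (ρ.pullCohomology G k c) -
          DirectSum.of (fun W : CechCover X => W.NerveCohomology G k) U c}) ⟨U, V, ρ, c, rfl⟩
      rw [h1, map_zero, zero_sub, SetLike.mem_coe, neg_mem_iff] at h2
      convert! h2
  refine subsingleton_of_forall_eq 0 fun z => ?_
  obtain ⟨w, rfl⟩ := QuotientAddGroup.mk_surjective z
  exact (QuotientAddGroup.eq_zero_iff w).2 (key w)

end Cech

/-! ### Pushing a map of small Hausdorff dimension into a skeleton. -/

section PushOffFaces

variable {ι : Type*} [Fintype ι]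

/-- A set of Hausdorff dimension less than `k` misses a point of every open `k`-face of the
standard simplex. -/
theorem exists_notMem_openFace_of_dimH_lt {S : Set (ι → ℝ)} {k : ℕ} (hS : dimH S < k)
    {σ : Finset ι} (hσ : σ.card = k + 1) :
    ∃ p ∉ S, (∀ i ∈ σ, 0 < p i) ∧ (∀ i ∉ σ, p i = 0) ∧ ∑ i, p i = 1 := by
  classical
  by_contra! hcon
  obtain ⟨i₀, hi₀⟩ : σ.Nonempty := Finset.card_pos.1 (by omega)
  set τ := σ.erase i₀ with hτ
  have hτc : Fintype.card τ = k := by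
    rw [Fintype.card_coe, Finset.card_erase_of_mem hi₀, hσ, Nat.add_sub_cancel]
  -- Barycentric coordinates sum to one, so forgetting the one at `i₀` identifies the open face with
  -- the open set `O` in `ℝ ^ k`. If `S` contained the face, its image under the 1-Lipschitz map `ρ`
  -- would contain `O`, which has dimension `k`.
  let ρ : (ι → ℝ) → (τ → ℝ) := fun t i => t i
  have hρ : LipschitzWith 1 ρ := LipschitzWith.mk_one fun s t =>
    (dist_pi_le_iff dist_nonneg).2 fun i => dist_le_pi_dist s t i
  let O : Set (τ → ℝ) := {y | (∀ i, 0 < y i) ∧ ∑ i, y i < 1}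
  have hO : IsOpen O := by
    have h1 : IsOpen {y : τ → ℝ | ∀ i, 0 < y i} := by
      simp only [ofPred_forall]
      exact isOpen_iInter_of_finite fun i => isOpen_lt continuous_const (continuous_apply i)
    exact h1.inter (isOpen_lt (f := fun y : τ → ℝ => ∑ i, y i) (by fun_prop) continuous_const)
  have hne : O.Nonempty := by
    refine ⟨fun _ => 1 / (k + 1), fun _ => by positivity, ?_⟩
    rw [Finset.sum_const, Finset.card_univ, hτc, nsmul_eq_mul, mul_one_div, div_lt_one (by positivity)]
    linarith
  have hOS : O ⊆ ρ '' S := by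
    rintro y ⟨hy, hy1⟩
    let p : ι → ℝ := fun i => if h : i ∈ τ then y ⟨i, h⟩ else if i = i₀ then 1 - ∑ j, y j else 0
    have hpτ : ∀ i : τ, p i = y i := fun i => by simp [p]
    have hp0 : p i₀ = 1 - ∑ j, y j := by simp [p, hτ]
    have hpn : ∀ i ∉ σ, p i = 0 := fun i hi => by
      have h1 : i ∉ τ := fun h => hi (Finset.mem_of_mem_erase h)
      have h2 : i ≠ i₀ := fun h => hi (h ▸ hi₀)
      simp [p, h1, h2]
    by_contra hy'
    refine hcon p (fun hp => hy' ⟨p, hp, funext hpτ⟩) (fun i hi => ?_) hpn ?_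
    · rcases eq_or_ne i i₀ with rfl | hne
      · rw [hp0]; linarith
      · have := hpτ ⟨i, Finset.mem_erase.2 ⟨hne, hi⟩⟩
        simp only at this
        rw [this]; exact hy _
    · rw [← Finset.sum_subset (Finset.subset_univ σ) fun i _ hi => hpn i hi,
        ← Finset.add_sum_erase σ p hi₀, ← Finset.sum_coe_sort, hp0, Finset.sum_congr rfl fun i _ => hpτ i]
      exact sub_add_cancel _ _
  have h1 : dimH O = k := by
    rw [Real.dimH_of_nonempty_interior (by rwa [hO.interior_eq]), Module.finrank_fintype_fun_eq_card,
      hτc]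
  exact absurd (((dimH_mono hOS).trans (hρ.dimH_image_le S)).trans_lt hS) (by rw [h1]; simp)

/-- If `c` is a Lipschitz function and `F` is continuously differentiable, then
`t ↦ F (t, c t)` does not increase the Hausdorff dimension. -/
theorem dimH_image_prodMk_le {c : (ι → ℝ) → ℝ} {K : ℝ≥0} (hc : LipschitzWith K c)
    {F : (ι → ℝ) × ℝ → ι → ℝ} {S : Set (ι → ℝ)} (hF : ∀ t ∈ S, ContDiffAt ℝ 1 F (t, c t)) :
    dimH ((fun t => F (t, c t)) '' S) ≤ dimH S := by
  refine dimH_image_le_of_locally_lipschitzOn fun t ht => ?_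
  obtain ⟨C, u, hu, hC⟩ := (hF t ht).exists_lipschitzOnWith
  have hg : LipschitzWith (max 1 K) fun t => (t, c t) := LipschitzWith.id.prodMk hc
  refine ⟨C * max 1 K, (fun t => (t, c t)) ⁻¹' u,
    mem_nhdsWithin_of_mem_nhds (hg.continuous.continuousAt.preimage_mem_nhds hu), ?_⟩
  exact hC.comp hg.lipschitzOnWith (mapsTo_preimage _ _)

/-- Pushing a map to the standard simplex off the open face `σ` (and all faces containing it),
by projecting radially from a point of the open face missed by the map. -/
theorem exists_push_off_face {X : Type*} [TopologicalSpace X] {k : ℕ} {f : X → ι → ℝ}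
    (hf : Continuous f) (hs : ∀ x, f x ∈ stdSimplex ℝ ι) (hd : dimH (range f) < k)
    {σ : Finset ι} (hσ : σ.card = k + 1) :
    ∃ g : X → ι → ℝ, Continuous g ∧ (∀ x, g x ∈ stdSimplex ℝ ι) ∧ dimH (range g) < k ∧
      (∀ x i, f x i = 0 → g x i = 0) ∧ ∀ x, ∃ i ∈ σ, g x i = 0 := by
  obtain ⟨p, hpS, hp, hp0, hp1⟩ := exists_notMem_openFace_of_dimH_lt hd hσ
  have hne : σ.Nonempty := Finset.card_pos.1 (by omega)
  -- `c t` is the largest `c` for which `t - c • p` is nonnegative on `σ`. The ray from `p` through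
  -- `t` leaves the simplex at `(1 - c t)⁻¹ • (t - c t • p)`, where a coordinate attaining the
  -- minimum vanishes.
  let c : (ι → ℝ) → ℝ := fun t => σ.inf' hne fun i => t i / p i
  have hc_le : ∀ t, ∀ i ∈ σ, c t * p i ≤ t i := fun t i hi =>
    (le_div_iff₀ (hp i hi)).1 (Finset.inf'_le _ hi)
  have hc_eq : ∀ t, ∃ i ∈ σ, t i = c t * p i := fun t => by
    obtain ⟨i, hi, h⟩ := Finset.exists_mem_eq_inf' hne fun i => t i / p i
    exact ⟨i, hi, ((eq_div_iff (hp i hi).ne').1 h).symm⟩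
  have hcL : LipschitzWith (∑ i ∈ σ, (p i).toNNReal⁻¹) c := by
    refine LipschitzWith.of_le_add_mul _ fun s t => ?_
    obtain ⟨i, hi, h⟩ := Finset.exists_mem_eq_inf' hne fun i => t i / p i
    have h1 : s i ≤ t i + dist s t := by
      have := (le_abs_self _).trans (dist_le_pi_dist s t i)
      linarith
    have h2 : (p i)⁻¹ ≤ ((∑ i ∈ σ, (p i).toNNReal⁻¹ : ℝ≥0) : ℝ) := by
      have := Finset.single_le_sum (f := fun i => (p i).toNNReal⁻¹) (fun i _ => zero_le) hi
      rw [← NNReal.coe_le_coe, NNReal.coe_inv, Real.coe_toNNReal _ (hp i hi).le] at this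
      exact this
    calc c s ≤ s i / p i := Finset.inf'_le _ hi
      _ ≤ (t i + dist s t) / p i := div_le_div_of_nonneg_right h1 (hp i hi).le
      _ = c t + (p i)⁻¹ * dist s t := by
        rw [show c t = t i / p i from h]; ring
      _ ≤ _ := by gcongr
  have hc0 : ∀ x, 0 ≤ c (f x) := fun x =>
    Finset.le_inf' _ _ fun i hi => div_nonneg ((hs x).1 i) (hp i hi).le
  -- If `c (f x) ≥ 1`, then `f x` dominates `p` coordinatewise with the same sum, so it equals the
  -- missed point `p`.
  have hc1 : ∀ x, c (f x) < 1 := fun x => by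
    by_contra! hcon
    refine hpS ⟨x, ?_⟩
    have hle : ∀ i ∈ Finset.univ, p i ≤ f x i := fun i _ => by
      by_cases hi : i ∈ σ
      · have := hc_le (f x) i hi
        nlinarith [hp i hi]
      · rw [hp0 i hi]; exact (hs x).1 i
    have := (Finset.sum_eq_sum_iff_of_le hle).1 (by rw [hp1, (hs x).2])
    exact funext fun i => (this i (Finset.mem_univ i)).symm
  -- The value of `c` is a separate variable because `c` is only Lipschitz, whereas `F` is smooth
  -- where that variable differs from one.
  let F : (ι → ℝ) × ℝ → ι → ℝ := fun z => (1 - z.2)⁻¹ • (z.1 - z.2 • p)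
  have hF : ∀ x, ContDiffAt ℝ 1 F (f x, c (f x)) := fun x => by
    have h1 : ContDiffAt ℝ 1 (fun z : (ι → ℝ) × ℝ => 1 - z.2) (f x, c (f x)) := by fun_prop
    exact (h1.inv (sub_pos.2 (hc1 x)).ne').smul (by fun_prop)
  have hval : ∀ x i, F (f x, c (f x)) i = (1 - c (f x))⁻¹ * (f x i - c (f x) * p i) :=
    fun x i => rfl
  have hpos : ∀ x, 0 ≤ (1 - c (f x))⁻¹ := fun x => inv_nonneg.2 (sub_pos.2 (hc1 x)).le
  refine ⟨fun x => F (f x, c (f x)), ?_, fun x => ⟨fun i => ?_, ?_⟩, ?_, fun x i hi => ?_,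
    fun x => ?_⟩
  · refine continuous_iff_continuousAt.2 fun x => ?_
    exact ContinuousAt.comp (f := fun x => (f x, c (f x))) (hF x).continuousAt
      (hf.prodMk (hcL.continuous.comp hf)).continuousAt
  · beta_reduce
    rw [hval]
    refine mul_nonneg (hpos x) (sub_nonneg.2 ?_)
    by_cases hi : i ∈ σ
    · exact hc_le _ i hi
    · rw [hp0 i hi, mul_zero]; exact (hs x).1 i
  · simp only [hval]
    rw [← Finset.mul_sum, Finset.sum_sub_distrib, ← Finset.mul_sum, hp1, (hs x).2, mul_one,
      inv_mul_cancel₀ (sub_pos.2 (hc1 x)).ne']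
  · refine lt_of_le_of_lt ?_ hd
    rw [range_comp' (fun t => F (t, c t)) f]
    refine dimH_image_prodMk_le hcL ?_
    rintro _ ⟨x, rfl⟩
    exact hF x
  · beta_reduce
    rw [hval, hi]
    by_cases h : i ∈ σ
    -- A zero coordinate in `σ` forces `c (f x) = 0`, so the projection leaves `f x` fixed.
    · have := hc_le (f x) i h
      rw [hi] at this
      have h0 : c (f x) * p i = 0 := le_antisymm this (mul_nonneg (hc0 x) (hp i h).le)
      simp [h0]
    · simp [hp0 i h]
  · obtain ⟨i, hi, h⟩ := hc_eq (f x)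
    exact ⟨i, hi, by beta_reduce; rw [hval, h, sub_self, mul_zero]⟩

/-- A map to the standard simplex whose image has Hausdorff dimension less than `k` can be pushed
into the `(k - 1)`-skeleton. -/
theorem exists_push_to_skeleton {X : Type*} [TopologicalSpace X] {k : ℕ} {f : X → ι → ℝ}
    (hf : Continuous f) (hs : ∀ x, f x ∈ stdSimplex ℝ ι) (hd : dimH (range f) < k) :
    ∃ g : X → ι → ℝ, Continuous g ∧ (∀ x, g x ∈ stdSimplex ℝ ι) ∧
      (∀ x i, f x i = 0 → g x i = 0) ∧
      ∀ x, ∀ σ : Finset ι, σ.card = k + 1 → ∃ i ∈ σ, g x i = 0 := by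
  classical
  -- The faces can be treated one by one in any order: a push never makes a vanishing coordinate
  -- nonzero, so earlier pushes are not undone, and it keeps the dimension of the image below `k`.
  have key : ∀ T : Finset (Finset ι), (∀ σ ∈ T, σ.card = k + 1) →
      ∃ g : X → ι → ℝ, Continuous g ∧ (∀ x, g x ∈ stdSimplex ℝ ι) ∧ dimH (range g) < k ∧
        (∀ x i, f x i = 0 → g x i = 0) ∧ ∀ x, ∀ σ ∈ T, ∃ i ∈ σ, g x i = 0 := by
    intro T
    induction T using Finset.induction_on with
    | empty => exact fun _ => ⟨f, hf, hs, hd, fun _ _ h => h, by simp⟩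
    | insert σ T _ ih =>
      intro hT
      obtain ⟨g, hg, hgs, hgd, hgf, hgT⟩ := ih fun τ hτ => hT τ (Finset.mem_insert_of_mem hτ)
      obtain ⟨g', hg', hgs', hgd', hgf', hgT'⟩ :=
        exists_push_off_face hg hgs hgd (hT σ (Finset.mem_insert_self σ T))
      refine ⟨g', hg', hgs', hgd', fun x i h => hgf' x i (hgf x i h), fun x τ hτ => ?_⟩
      rcases Finset.mem_insert.1 hτ with rfl | hτ
      · exact hgT' x
      · obtain ⟨i, hi, h⟩ := hgT x τ hτ
        exact ⟨i, hi, hgf' x i h⟩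
  obtain ⟨g, hg, hgs, -, hgf, hgT⟩ :=
    key (Finset.univ.filter fun σ => σ.card = k + 1) (by simp)
  exact ⟨g, hg, hgs, hgf, fun x σ hσ => hgT x σ (by simpa using hσ)⟩

/-- Normalising a positive vector does not increase the Hausdorff dimension. -/
theorem dimH_range_normalize_le {X : Type*} {h : X → ι → ℝ} (hpos : ∀ x, 0 < ∑ i, h x i) :
    dimH (range fun x => (∑ i, h x i)⁻¹ • h x) ≤ dimH (range h) := by
  rw [range_comp' (fun t : ι → ℝ => (∑ i, t i)⁻¹ • t) h]
  refine dimH_image_le_of_locally_lipschitzOn ?_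
  rintro _ ⟨x, rfl⟩
  have h1 : ContDiffAt ℝ 1 (fun t : ι → ℝ => ∑ i, t i) (h x) := by fun_prop
  have h2 : ContDiffAt ℝ 1 (fun t : ι → ℝ => (∑ i, t i)⁻¹ • t) (h x) :=
    (h1.inv (hpos x).ne').smul contDiffAt_id
  obtain ⟨C, u, hu, hC⟩ := h2.exists_lipschitzOnWith
  exact ⟨C, u, mem_nhdsWithin_of_mem_nhds hu, hC⟩

end PushOffFaces

/-! ### Covering dimension is controlled by Hausdorff dimension. -/

section DimensionBound

universe u

/-- Truncating at 1 keeps the value finite, also when `A` is empty: the distance is then `⊤`, and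
the truncated function is 1 rather than `(⊤).toReal = 0`. This matters for a cover member equal to
the whole space. -/
theorem lipschitzWith_min_one_infEDist {X : Type*} [PseudoEMetricSpace X] (A : Set X) :
    LipschitzWith 1 fun x => (min 1 (Metric.infEDist x A)).toReal := by
  have hfin : ∀ x, min 1 (Metric.infEDist x A) ≠ ⊤ := fun x =>
    ((min_le_left _ _).trans_lt ENNReal.one_lt_top).ne
  have key : ∀ x y, edist x y ≠ ⊤ → (min 1 (Metric.infEDist x A)).toReal ≤
      (min 1 (Metric.infEDist y A)).toReal + (edist x y).toReal := fun x y hxy => by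
    rw [← ENNReal.toReal_add (hfin y) hxy]
    refine ENNReal.toReal_mono (ENNReal.add_ne_top.2 ⟨hfin y, hxy⟩) ?_
    rcases le_total 1 (Metric.infEDist y A) with h | h
    · rw [min_eq_left h]
      exact (min_le_left _ _).trans le_self_add
    · rw [min_eq_right h]
      exact (min_le_right _ _).trans Metric.infEDist_le_infEDist_add_edist
  intro x y
  rw [ENNReal.coe_one, one_mul]
  by_cases hxy : edist x y = ⊤
  · rw [hxy]; exact le_top
  rw [edist_dist, Real.dist_eq, ENNReal.ofReal_le_iff_le_toReal hxy, abs_sub_le_iff]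
  have h1 := key x y hxy
  have h2 := key y x (by rwa [edist_comm])
  rw [edist_comm y x] at h2
  constructor <;> linarith

/-- If all Lipschitz images of a compact space in finite-dimensional cubes have Hausdorff
dimension less than `k`, then its Čech cohomology in degree `k` vanishes. -/
theorem CechCohomology.subsingleton_of_dimH_lt {X : Type u} [PseudoEMetricSpace X] [CompactSpace X]
    (G : Type*) [AddCommGroup G] (k : ℕ)
    (H : ∀ (ι : Type u) [Fintype ι] (K : ℝ≥0) (h : X → ι → ℝ), LipschitzWith K h →
      dimH (range h) < k) :
    Subsingleton (CechCohomology X G k) := by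
  classical
  refine CechCohomology.subsingleton_of_refinement G k fun U => ?_
  obtain ⟨T, hT⟩ := isCompact_univ.elim_finite_subcover (fun A : U.sets => (A : Set X))
    (fun A => U.isOpen A A.2) (by rw [← sUnion_eq_iUnion, U.sUnion_eq])
  -- The coordinate at `A` is nonzero exactly on `A`, so the normalised `h` is a partition of unity
  -- subordinate to the subcover.
  let h : X → T → ℝ := fun x A => (min 1 (Metric.infEDist x (A.1 : Set X)ᶜ)).toReal
  have hL : LipschitzWith 1 h := LipschitzWith.of_edist_le fun x y => by
    refine edist_pi_le_iff.2 fun A => ?_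
    simpa using lipschitzWith_min_one_infEDist (A.1 : Set X)ᶜ x y
  have hh0 : ∀ x A, 0 ≤ h x A := fun x A => ENNReal.toReal_nonneg
  have hmem : ∀ x A, h x A ≠ 0 ↔ x ∈ (A.1 : Set X) := fun x A => by
    have hfin : min 1 (Metric.infEDist x (A.1 : Set X)ᶜ) ≠ ⊤ :=
      ((min_le_left _ _).trans_lt ENNReal.one_lt_top).ne
    have hcl : IsClosed (A.1 : Set X)ᶜ := (U.isOpen _ A.1.2).isClosed_compl
    rw [← not_iff_not, not_not, ← mem_compl_iff, Metric.mem_iff_infEDist_zero_of_closed hcl]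
    simp [h, ENNReal.toReal_eq_zero_iff, hfin, min_eq_iff]
    exact fun h0 => h0.trans_le zero_le
  have hpos : ∀ x, 0 < ∑ A, h x A := fun x => by
    obtain ⟨A, hA, hx⟩ := mem_iUnion₂.1 (hT (mem_univ x))
    exact Finset.sum_pos' (fun A _ => hh0 x A)
      ⟨⟨A, hA⟩, Finset.mem_univ _, (hh0 _ _).lt_of_ne ((hmem x ⟨A, hA⟩).2 hx).symm⟩
  have hfc : Continuous fun x => (∑ A, h x A)⁻¹ • h x := by
    have := hL.continuous
    exact (Continuous.inv₀ (by fun_prop) fun x => (hpos x).ne').smul this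
  obtain ⟨g, hg, hgs, hgf, hgk⟩ := exists_push_to_skeleton hfc
    (fun x => ⟨fun A => mul_nonneg (inv_nonneg.2 (hpos x).le) (hh0 x A), by
      simp only [Pi.smul_apply, smul_eq_mul]
      rw [← Finset.mul_sum, inv_mul_cancel₀ (hpos x).ne']⟩)
    ((dimH_range_normalize_le hpos).trans_lt (H T 1 h hL))
  -- The members are the preimages under `g` of the open stars of the vertices.
  let V : CechCover X :=
    { sets := range fun A : T => {x | 0 < g x A}
      isOpen := by
        rintro _ ⟨A, rfl⟩
        exact isOpen_lt continuous_const ((continuous_apply A).comp hg)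
      sUnion_eq := by
        refine eq_univ_of_forall fun x => ?_
        obtain ⟨A, -, hA⟩ := Finset.exists_lt_of_sum_lt (s := Finset.univ) (f := fun _ : T => (0 : ℝ))
          (g := g x) (by rw [(hgs x).2]; simp)
        exact ⟨_, ⟨A, rfl⟩, hA⟩ }
  choose a ha using fun B : V.sets => B.2
  refine ⟨V, ⟨⟨fun B => (a B).1, fun B x hx => ?_⟩⟩, fun σ hσ => ?_⟩
  -- The push keeps zero coordinates zero, so the star preimage at `A` still lies in `A`.
  · rw [← ha B] at hx
    refine (hmem x (a B)).1 fun h0 => ne_of_gt (show 0 < g x (a B) from hx) (hgf x _ ?_)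
    simp [h0]
  · obtain ⟨x, hx⟩ := σ.2
    -- Distinct members come from distinct vertices. At a common point of `k + 1` of them, all
    -- coordinates of a face with `k + 1` vertices would be positive, which the skeleton condition
    -- excludes.
    have hinj : Function.Injective fun j => a (σ.1 j) := fun i j hij => by
      refine hσ (Subtype.ext ?_)
      rw [← ha (σ.1 i), ← ha (σ.1 j)]
      exact congrArg (fun A => {x | 0 < g x A}) hij
    obtain ⟨A, hA, hA0⟩ := hgk x (Finset.univ.image fun j => a (σ.1 j)) (by
      rw [Finset.card_image_of_injective _ hinj, Finset.card_univ, Fintype.card_fin])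
    obtain ⟨j, -, rfl⟩ := Finset.mem_image.1 hA
    have := mem_iInter.1 hx j
    rw [← ha (σ.1 j)] at this
    exact ne_of_gt (show 0 < g x (a (σ.1 j)) from this) hA0

end DimensionBound

/-! ### Lipschitz parametrization of the thickening by points and weights. -/

noncomputable section Parametrization

section WeightedDirac

variable {X : Type*} [MeasurableSpace X] {ι : Type*} [Fintype ι]

/-- The measure `∑ i, l i • δ_{x i}`. -/
def weightedDirac (x : ι → X) (l : ι → ℝ) : Measure X :=
  ∑ i, ENNReal.ofReal (l i) • Measure.dirac (x i)

theorem map_sum_smul_dirac {Y Z : Type*} [MeasurableSpace Y] [MeasurableSpace Z] {f : Y → Z}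
    (hf : Measurable f) (y : ι → Y) (c : ι → ℝ≥0∞) :
    (∑ i, c i • Measure.dirac (y i)).map f = ∑ i, c i • Measure.dirac (f (y i)) := by
  rw [← Measure.mapₗ_apply_of_measurable hf, map_sum]
  refine Finset.sum_congr rfl fun i _ => ?_
  rw [Measure.mapₗ_apply_of_measurable hf, Measure.map_smul, Measure.map_dirac' hf]

theorem weightedDirac_univ (x : ι → X) (l : ι → ℝ) :
    weightedDirac x l univ = ∑ i, ENNReal.ofReal (l i) := by
  simp [weightedDirac, Measure.finsetSum_apply]

instance (x : ι → X) (l : ι → ℝ) : IsFiniteMeasure (weightedDirac x l) :=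
  ⟨by rw [weightedDirac_univ]; exact ENNReal.sum_lt_top.2 fun i _ => ENNReal.ofReal_lt_top⟩

theorem weightedDirac_add (x : ι → X) {l l' : ι → ℝ} (hl : ∀ i, 0 ≤ l i) (hl' : ∀ i, 0 ≤ l' i) :
    weightedDirac x l + weightedDirac x l' = weightedDirac x (l + l') := by
  simp only [weightedDirac, ← Finset.sum_add_distrib, ← add_smul, Pi.add_apply]
  exact Finset.sum_congr rfl fun i _ => by rw [ENNReal.ofReal_add (hl i) (hl' i)]

end WeightedDirac

variable {X : Type*} [MetricSpace X] {ι : Type*} [Fintype ι]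

/-- The parameters of points of the anti-Vietoris--Rips thickening: tuples of points any two of
which are equal or at distance at least `r`, with barycentric weights. -/
def antiVRParameters (X : Type*) [MetricSpace X] (ι : Type*) [Fintype ι] (r : ℝ) :
    Set ((ι → X) × (ι → ℝ)) :=
  {z | (∀ i j, z.1 i = z.1 j ∨ r ≤ dist (z.1 i) (z.1 j)) ∧ z.2 ∈ stdSimplex ℝ ι}

/-- Coincidence and distance at least `r` are both closed conditions. Allowing coincidences is also
what lets a fixed number of points represent measures with fewer atoms. -/
theorem isCompact_antiVRParameters [CompactSpace X] (r : ℝ) :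
    IsCompact (antiVRParameters X ι r) := by
  refine (isCompact_univ.prod (isCompact_stdSimplex ℝ ι)).of_isClosed_subset ?_
    fun z hz => ⟨mem_univ _, hz.2⟩
  refine IsClosed.inter ?_ ((isClosed_stdSimplex ℝ ι).preimage continuous_snd)
  change IsClosed {z : (ι → X) × (ι → ℝ) | ∀ i j, z.1 i = z.1 j ∨ r ≤ dist (z.1 i) (z.1 j)}
  simp only [ofPred_forall, ofPred_or]
  refine isClosed_iInter fun i => isClosed_iInter fun j => IsClosed.union ?_ ?_
  · exact isClosed_eq (by fun_prop) (by fun_prop)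
  · exact isClosed_le continuous_const (by fun_prop)

/-- Points of zero weight are dropped, and coinciding points are merged with their weights added. -/
theorem isAntiVRMeasure_weightedDirac [MeasurableSpace X] {r : ℝ} {z : (ι → X) × (ι → ℝ)}
    (hz : z ∈ antiVRParameters X ι r) : IsAntiVRMeasure r (weightedDirac z.1 z.2) := by
  classical
  obtain ⟨x, l⟩ := z
  obtain ⟨hx, hl⟩ := hz
  set F : Finset ι := Finset.univ.filter fun i => 0 < l i with hF
  have hF0 : ∀ i ∈ Finset.univ, i ∉ F → l i = 0 := fun i _ hi =>
    le_antisymm (not_lt.1 fun h => hi (Finset.mem_filter.2 ⟨Finset.mem_univ i, h⟩)) (hl.1 i)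
  have hmaps : ∀ i ∈ F, x i ∈ F.image x := fun i hi => Finset.mem_image_of_mem x hi
  refine ⟨F.image x, fun y => ∑ i ∈ F with x i = y, (l i).toNNReal, ?_, ?_, ?_, ?_⟩
  · intro y hy
    obtain ⟨i, hi, rfl⟩ := Finset.mem_image.1 hy
    have hi' : 0 < (l i).toNNReal := Real.toNNReal_pos.2 (Finset.mem_filter.1 hi).2
    exact hi'.trans_le (Finset.single_le_sum (f := fun i => (l i).toNNReal) (fun _ _ => zero_le)
      (Finset.mem_filter.2 ⟨hi, rfl⟩))
  · rw [Finset.sum_fiberwise_of_maps_to hmaps, ← Real.toNNReal_sum_of_nonneg fun i _ => hl.1 i,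
      Finset.sum_subset (Finset.subset_univ F) hF0, hl.2, Real.toNNReal_one]
  · intro y hy y' hy' hne
    obtain ⟨i, -, rfl⟩ := Finset.mem_image.1 (Finset.mem_coe.1 hy)
    obtain ⟨j, -, rfl⟩ := Finset.mem_image.1 (Finset.mem_coe.1 hy')
    exact (hx i j).resolve_left hne
  · have h1 : weightedDirac x l = ∑ i ∈ F, ENNReal.ofReal (l i) • Measure.dirac (x i) :=
      (Finset.sum_subset (Finset.subset_univ F) fun i hi hi' => by
        rw [hF0 i hi hi', ENNReal.ofReal_zero, zero_smul]).symm
    change weightedDirac x l = _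
    rw [h1, ← Finset.sum_fiberwise_of_maps_to hmaps]
    refine Finset.sum_congr rfl fun y _ => ?_
    rw [ENNReal.ofNNReal_finsetSum, Finset.sum_smul]
    refine Finset.sum_congr rfl fun i hi => ?_
    rw [(Finset.mem_filter.1 hi).2]
    rfl

variable [MeasurableSpace X] [BorelSpace X]

theorem lintegral_sum_smul_dirac_edist (x y : ι → X) (c : ι → ℝ≥0∞) :
    ∫⁻ z, edist z.1 z.2 ∂(∑ i, c i • Measure.dirac (x i, y i)) =
      ∑ i, c i * edist (x i) (y i) := by
  rw [lintegral_finsetSum_measure]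
  exact Finset.sum_congr rfl fun i _ => by rw [lintegral_smul_measure, lintegral_dirac, smul_eq_mul]

/-- Moving the points of a finitely supported measure. -/
theorem wassersteinEDist_move_le (x y : ι → X) (l : ι → ℝ) :
    wassersteinEDist (weightedDirac x l) (weightedDirac y l) ≤
      ∑ i, ENNReal.ofReal (l i) * edist (x i) (y i) := by
  refine (iInf₂_le (∑ i, ENNReal.ofReal (l i) • Measure.dirac (x i, y i))
    ⟨map_sum_smul_dirac measurable_fst _ _, map_sum_smul_dirac measurable_snd _ _⟩).trans ?_
  rw [lintegral_sum_smul_dirac_edist]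

/-- Changing the weights of a finitely supported probability measure. -/
theorem wassersteinEDist_reweight_le {C : ℝ≥0∞} (hC : ∀ x y : X, edist x y ≤ C)
    (x : ι → X) {l l' : ι → ℝ} (hl : l ∈ stdSimplex ℝ ι) (hl' : l' ∈ stdSimplex ℝ ι) :
    wassersteinEDist (weightedDirac x l) (weightedDirac x l') ≤
      C * ∑ i, ENNReal.ofReal |l i - l' i| := by
  -- The common part `m` of the weights stays in place. Only the excess `α` is transported to the
  -- deficit `β`, by the product coupling divided by their common mass `a`.
  set m : ι → ℝ := fun i => min (l i) (l' i) with hm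
  have hm0 : ∀ i, 0 ≤ m i := fun i => le_min (hl.1 i) (hl'.1 i)
  have hlm : ∀ i, 0 ≤ (l - m) i := fun i => sub_nonneg.2 (min_le_left _ _)
  have hlm' : ∀ i, 0 ≤ (l' - m) i := fun i => sub_nonneg.2 (min_le_right _ _)
  set α := weightedDirac x (l - m) with hα
  set β := weightedDirac x (l' - m) with hβ
  set a : ℝ≥0∞ := α univ with ha
  have hαβ : β univ = a := by
    rw [ha, hα, hβ, weightedDirac_univ, weightedDirac_univ,
      ← ENNReal.ofReal_sum_of_nonneg fun i _ => hlm i,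
      ← ENNReal.ofReal_sum_of_nonneg fun i _ => hlm' i]
    simp only [Pi.sub_apply, Finset.sum_sub_distrib, hl.2, hl'.2]
  have ha_top : a ≠ ⊤ := measure_ne_top _ _
  have key : ∀ τ : Measure X, τ univ = a → a⁻¹ • (a • τ) = τ := by
    intro τ hτ
    -- When `a = 0` the factor `a⁻¹` is `⊤`, but `τ` is then zero.
    rcases eq_or_ne a 0 with h0 | h0
    · rw [h0, Measure.measure_univ_eq_zero] at hτ
      simp [hτ]
    · rw [smul_smul, ENNReal.inv_mul_cancel h0 ha_top, one_smul]
  refine (iInf₂_le (∑ i, ENNReal.ofReal (m i) • Measure.dirac (x i, x i) + a⁻¹ • α.prod β)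
    ⟨?fst, ?snd⟩).trans ?cost
  case fst =>
    rw [Measure.map_add _ _ measurable_fst, Measure.map_smul, Measure.map_fst_prod, hαβ,
      key α rfl, map_sum_smul_dirac measurable_fst]
    exact (weightedDirac_add x hm0 hlm).trans (by rw [add_sub_cancel])
  case snd =>
    rw [Measure.map_add _ _ measurable_snd, Measure.map_smul, Measure.map_snd_prod,
      key β hαβ, map_sum_smul_dirac measurable_snd]
    exact (weightedDirac_add x hm0 hlm').trans (by rw [add_sub_cancel])
  case cost =>
    rw [lintegral_add_measure, lintegral_sum_smul_dirac_edist, lintegral_smul_measure]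
    simp only [edist_self, mul_zero, Finset.sum_const_zero, zero_add, smul_eq_mul]
    have h1 : ∫⁻ z, edist z.1 z.2 ∂(α.prod β) ≤ C * (a * a) := by
      refine (lintegral_mono fun z : X × X => hC z.1 z.2).trans (le_of_eq ?_)
      rw [lintegral_const, ← univ_prod_univ, Measure.prod_prod, hαβ]
    have h2 : a ≤ ∑ i, ENNReal.ofReal |l i - l' i| := by
      rw [ha, hα, weightedDirac_univ]
      refine Finset.sum_le_sum fun i _ => ENNReal.ofReal_le_ofReal ?_
      rcases le_total (l i) (l' i) with h | h
      · simp [hm, h]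
      · rw [Pi.sub_apply, hm]
        exact (min_eq_right h).symm ▸ le_abs_self _
    calc a⁻¹ * ∫⁻ z, edist z.1 z.2 ∂(α.prod β) ≤ a⁻¹ * (C * (a * a)) := by gcongr
      _ = C * ((a⁻¹ * a) * a) := by ring
      _ ≤ C * (1 * a) := by
        gcongr
        exact ENNReal.inv_mul_le_one a
      _ ≤ _ := by rw [one_mul]; gcongr

/-- Pass through `weightedDirac y l`: moving the points costs at most the distance of the parameters
because the weights sum to one, and reweighting costs at most `C` times the `ℓ¹` distance of the
weights, hence the factor `Fintype.card ι`. -/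
theorem wassersteinEDist_weightedDirac_le {C : ℝ≥0∞} (hC : ∀ x y : X, edist x y ≤ C)
    (x y : ι → X) {l l' : ι → ℝ} (hl : l ∈ stdSimplex ℝ ι) (hl' : l' ∈ stdSimplex ℝ ι) :
    wassersteinEDist (weightedDirac x l) (weightedDirac y l') ≤
      (1 + C * Fintype.card ι) * edist (x, l) (y, l') := by
  classical
  have hs : weightedDirac y l (↑(Finset.univ.image y) : Set X)ᶜ = 0 := by
    rw [weightedDirac, Measure.finsetSum_apply]
    refine Finset.sum_eq_zero fun i _ => ?_
    rw [Measure.smul_apply, Measure.dirac_apply' _ (Finset.measurableSet _).compl]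
    simp
  refine (wassersteinEDist_triangle _ (weightedDirac y l) _ _ hs).trans ?_
  rw [add_mul, one_mul]
  refine add_le_add ((wassersteinEDist_move_le x y l).trans ?_)
    ((wassersteinEDist_reweight_le hC y hl hl').trans ?_)
  · calc ∑ i, ENNReal.ofReal (l i) * edist (x i) (y i)
        ≤ ∑ i, ENNReal.ofReal (l i) * edist (x, l) (y, l') := by
          gcongr with i
          exact (edist_le_pi_edist x y i).trans (le_max_left _ _)
      _ = edist (x, l) (y, l') := by
          rw [← Finset.sum_mul, ← ENNReal.ofReal_sum_of_nonneg fun i _ => hl.1 i, hl.2,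
            ENNReal.ofReal_one, one_mul]
  · rw [mul_assoc]
    gcongr
    calc ∑ i, ENNReal.ofReal |l i - l' i| ≤ ∑ _i : ι, edist (x, l) (y, l') := by
          gcongr with i
          rw [← Real.dist_eq, ← edist_dist]
          exact (edist_le_pi_edist l l' i).trans (le_max_right _ _)
      _ = _ := by simp

/-- The parametrization `(x, l) ↦ ∑ i, l i • δ_{x i}` of the anti-Vietoris--Rips thickening. -/
def antiVRParametrization (X : Type*) [MetricSpace X] [MeasurableSpace X] [BorelSpace X]
    (ι : Type*) [Fintype ι] (r : ℝ) (z : antiVRParameters X ι r) : AntiVRThickening X r :=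
  ⟨weightedDirac z.1.1 z.1.2, isAntiVRMeasure_weightedDirac z.2⟩

theorem exists_lipschitzWith_antiVRParametrization [CompactSpace X] (r : ℝ) :
    ∃ K, LipschitzWith K (antiVRParametrization X ι r) := by
  have hC : ∀ x y : X, edist x y ≤ Metric.ediam (univ : Set X) := fun x y =>
    Metric.edist_le_ediam_of_mem (mem_univ x) (mem_univ y)
  have hfin : 1 + Metric.ediam (univ : Set X) * Fintype.card ι ≠ ⊤ :=
    ENNReal.add_ne_top.2 ⟨ENNReal.one_ne_top, ENNReal.mul_ne_top
      (Metric.isBounded_of_compactSpace (s := (univ : Set X))).ediam_ne_top (ENNReal.natCast_ne_top _)⟩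
  refine ⟨(1 + Metric.ediam (univ : Set X) * Fintype.card ι).toNNReal, fun z z' => ?_⟩
  rw [ENNReal.coe_toNNReal hfin]
  exact wassersteinEDist_weightedDirac_le hC _ _ z.2.2 z'.2.2

theorem antiVRParametrization_surjective {r : ℝ} (hc : ∀ s : Finset X, IsPacking r (s : Set X) →
    s.card ≤ Fintype.card ι) : Function.Surjective (antiVRParametrization X ι r) := by
  classical
  rintro ⟨μ, s, w, hw, hw1, hs, rfl⟩
  obtain ⟨s₀, hs₀⟩ : s.Nonempty := Finset.nonempty_of_sum_ne_zero (f := w) (by rw [hw1]; simp)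
  obtain ⟨j⟩ : Nonempty (s ↪ ι) := Function.Embedding.nonempty_of_card_le (by
    rw [Fintype.card_coe]; exact hc s hs)
  -- Unused indices receive weight zero and a point `s₀` already in the support, so the spread
  -- condition is kept.
  set x : ι → X := Function.extend j Subtype.val fun _ => s₀ with hx
  set l : ι → ℝ := Function.extend j (fun a => (w a : ℝ)) 0 with hl
  have hxs : ∀ i, x i ∈ s := fun i => by
    by_cases hi : ∃ a, j a = i
    · obtain ⟨a, rfl⟩ := hi
      rw [hx, j.injective.extend_apply]; exact a.2
    · rw [hx, Function.extend_apply' _ _ _ hi]; exact hs₀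
  have hl0 : ∀ i ∉ range j, l i = 0 := fun i hi => by
    rw [hl, Function.extend_apply' _ _ _ hi]; rfl
  have hla : ∀ a, l (j a) = w a := fun a => j.injective.extend_apply _ _ _
  have hxa : ∀ a, x (j a) = a := fun a => j.injective.extend_apply _ _ _
  have hz : (x, l) ∈ antiVRParameters X ι r := by
    refine ⟨fun i i' => or_iff_not_imp_left.2 fun h => hs _ (hxs i) _ (hxs i') h, fun i => ?_, ?_⟩
    · by_cases hi : i ∈ range j
      · obtain ⟨a, rfl⟩ := hi
        exact (NNReal.coe_nonneg _).trans (hla a).ge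
      · exact (hl0 i hi).ge
    · rw [← Fintype.sum_of_injective j j.injective (fun a => (w a : ℝ)) l hl0
        fun a => (hla a).symm, Finset.sum_coe_sort s fun a => (w a : ℝ), ← NNReal.coe_sum, hw1,
        NNReal.coe_one]
  refine ⟨⟨(x, l), hz⟩, Subtype.ext ?_⟩
  change ∑ i, ENNReal.ofReal (l i) • Measure.dirac (x i) = _
  rw [← Fintype.sum_of_injective j j.injective (fun a => (w a : ℝ≥0∞) • Measure.dirac (a : X))
    (fun i => ENNReal.ofReal (l i) • Measure.dirac (x i))
    (fun i hi => by rw [hl0 i hi, ENNReal.ofReal_zero, zero_smul])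
    (fun a => by rw [hla, hxa, ENNReal.ofReal_coe_nnreal]),
    Finset.sum_coe_sort s fun a => (w a : ℝ≥0∞) • Measure.dirac (a : X)]

end Parametrization

/-! ### Hausdorff dimension of the parameter space. -/

section ManifoldDimension

/-- Recovers barycentric coordinates from all but the first, so that the `p`-simplex contributes
`p`, not `p + 1`, to the dimension. -/
theorem lipschitzWith_cons_one_sub_sum (p : ℕ) :
    LipschitzWith (p + 1) fun v : Fin p → ℝ => (Fin.cons (1 - ∑ i, v i) v : Fin (p + 1) → ℝ) := by
  refine LipschitzWith.of_dist_le_mul fun v w => (dist_pi_le_iff (by positivity)).2 fun i => ?_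
  have hd : (0 : ℝ) ≤ dist v w := dist_nonneg
  have hK : (((p : ℝ≥0) + 1 : ℝ≥0) : ℝ) = p + 1 := by push_cast; rfl
  rw [hK]
  refine Fin.cases ?_ (fun j => ?_) i
  · simp only [Fin.cons_zero, dist_sub_left]
    calc dist (∑ i, v i) (∑ i, w i) ≤ ∑ i, dist (v i) (w i) := dist_sum_sum_le _ _ _
      _ ≤ ∑ _i : Fin p, dist v w := Finset.sum_le_sum fun i _ => dist_le_pi_dist v w i
      _ ≤ (p + 1) * dist v w := by simp [add_mul, hd]
  · simp only [Fin.cons_succ]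
    refine (dist_le_pi_dist v w j).trans ?_
    have : (0 : ℝ) ≤ p * dist v w := by positivity
    linarith

/-- If a compact space is locally a Lipschitz image of subsets of an `n`-dimensional vector
space, then the product of its `(p + 1)`-st power with the `p`-simplex has Hausdorff dimension at
most `n (p + 1) + p`. -/
theorem dimH_pi_prod_stdSimplex_le {M F : Type*} [MetricSpace M] [CompactSpace M]
    [NormedAddCommGroup F] [NormedSpace ℝ F] [FiniteDimensional ℝ F]
    (hM : ∀ x : M, ∃ (C : ℝ≥0) (V : Set F) (ψ : F → M), LipschitzOnWith C ψ V ∧ ψ '' V ∈ 𝓝 x)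
    (p : ℕ) :
    dimH ((univ : Set (Fin (p + 1) → M)) ×ˢ stdSimplex ℝ (Fin (p + 1))) ≤
      ((Module.finrank ℝ F * (p + 1) + p : ℕ) : ℝ≥0∞) := by
  choose C V ψ hψ hV using hM
  obtain ⟨T, hT⟩ := finite_cover_nhds hV
  -- Hausdorff dimension is not subadditive under general products, so the whole product is covered
  -- by finitely many Lipschitz images of subsets of one vector space. The index `c` chooses a patch
  -- for each of the `p + 1` points.
  let A : (Fin (p + 1) → T) → Set ((Fin (p + 1) → F) × (Fin p → ℝ)) := fun c =>
    {u | ∀ i, u.1 i ∈ V (c i)}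
  let Ψ : (Fin (p + 1) → T) → (Fin (p + 1) → F) × (Fin p → ℝ) →
      (Fin (p + 1) → M) × (Fin (p + 1) → ℝ) := fun c u =>
    (fun i => ψ (c i) (u.1 i), Fin.cons (1 - ∑ i, u.2 i) u.2)
  have hΨ : ∀ c, LipschitzOnWith (∑ i, C (c i) + (p + 1)) (Ψ c) (A c) := fun c u hu v hv => by
    rw [Prod.edist_eq]
    refine max_le (edist_pi_le_iff.2 fun i => ?_) ?_
    · refine (hψ (c i) (hu i) (hv i)).trans ?_
      have h1 : C (c i) ≤ ∑ i, C (c i) + (p + 1) :=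
        (Finset.single_le_sum (f := fun i => C (c i)) (fun _ _ => zero_le)
          (Finset.mem_univ i)).trans le_self_add
      gcongr
      exact (edist_le_pi_edist u.1 v.1 i).trans (le_max_left _ _)
    · refine (lipschitzWith_cons_one_sub_sum p u.2 v.2).trans ?_
      have h1 : (p + 1 : ℝ≥0) ≤ ∑ i, C (c i) + (p + 1) := le_add_self
      gcongr
      exact le_max_right _ _
  have hcover : (univ : Set (Fin (p + 1) → M)) ×ˢ stdSimplex ℝ (Fin (p + 1)) ⊆
      ⋃ c, Ψ c '' A c := by
    rintro ⟨x, l⟩ ⟨-, hl⟩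
    have h1 : ∀ i, ∃ (t : T) (u : F), u ∈ V t ∧ ψ t u = x i := fun i => by
      have := hT.ge (mem_univ (x i))
      obtain ⟨t, ht, u, hu, hux⟩ := mem_iUnion₂.1 this
      exact ⟨⟨t, ht⟩, u, hu, hux⟩
    choose c u hu hux using h1
    refine mem_iUnion.2 ⟨c, (u, fun i => l i.succ), hu, Prod.ext (funext hux) ?_⟩
    have h0 : l 0 = 1 - ∑ i : Fin p, l i.succ := by
      rw [← hl.2, Fin.sum_univ_succ, add_sub_cancel_right]
    change (Fin.cons (1 - ∑ i : Fin p, l i.succ) fun i => l i.succ : Fin (p + 1) → ℝ) = l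
    rw [← h0]
    exact Fin.cons_self_tail l
  refine (dimH_mono hcover).trans ?_
  rw [dimH_iUnion]
  refine iSup_le fun c => (hΨ c).dimH_image_le.trans ((dimH_mono (subset_univ _)).trans ?_)
  rw [Real.dimH_univ_eq_finrank, Module.finrank_prod, Module.finrank_pi_fintype]
  simp [mul_comm]

end ManifoldDimension

/-! ### The vanishing theorem. -/

/-- The anti-Vietoris--Rips thickening at scale `r` of a compact space which is locally a Lipschitz
image of subsets of an `n`-dimensional vector space and whose packings have at most `p` points has
no Čech cohomology in degrees at least `(n + 1) * p`. -/
theorem AntiVRThickening.subsingleton_cechCohomology {M F : Type*} [MetricSpace M] [CompactSpace M]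
    [MeasurableSpace M] [BorelSpace M]
    [NormedAddCommGroup F] [NormedSpace ℝ F] [FiniteDimensional ℝ F]
    (hM : ∀ x : M, ∃ (C : ℝ≥0) (V : Set F) (ψ : F → M), LipschitzOnWith C ψ V ∧ ψ '' V ∈ 𝓝 x)
    (G : Type*) [AddCommGroup G] {r : ℝ} {p : ℕ}
    (hp : ∀ s : Finset M, IsPacking r (s : Set M) → s.card ≤ p)
    {k : ℕ} (hk : (Module.finrank ℝ F + 1) * p ≤ k) :
    Subsingleton (CechCohomology (AntiVRThickening M r) G k) := by
  -- If no nonempty packing exists, the thickening is empty and its nerves have no simplices.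
  -- Otherwise `p + 1` replaces the bound `p`, and the weights form a `p`-simplex.
  rcases p with - | p
  · have hempty : IsEmpty (AntiVRThickening M r) := by
      refine ⟨?_⟩
      rintro ⟨-, s, w, -, hw, hs, -⟩
      have := Finset.card_eq_zero.1 (Nat.le_zero.1 (hp s hs))
      simp [this] at hw
    refine CechCohomology.subsingleton_of_refinement G k fun U =>
      ⟨U, ⟨⟨id, fun _ => Subset.rfl⟩⟩, fun σ _ => ?_⟩
    obtain ⟨x, -⟩ := σ.2
    exact hempty.false x
  have hsurj : Function.Surjective (antiVRParametrization M (Fin (p + 1)) r) :=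
    antiVRParametrization_surjective fun s hs => by simpa using hp s hs
  obtain ⟨K, hK⟩ := exists_lipschitzWith_antiVRParametrization (X := M) (ι := Fin (p + 1)) r
  have : CompactSpace (antiVRParameters M (Fin (p + 1)) r) :=
    isCompact_iff_compactSpace.1 (isCompact_antiVRParameters r)
  have : CompactSpace (AntiVRThickening M r) := hsurj.compactSpace hK.continuous
  refine CechCohomology.subsingleton_of_dimH_lt G k fun ι _ L h hL => ?_
  calc dimH (range h) = dimH (range (h ∘ antiVRParametrization M (Fin (p + 1)) r)) := by
        rw [hsurj.range_comp]
    _ ≤ dimH (univ : Set (antiVRParameters M (Fin (p + 1)) r)) := (hL.comp hK).dimH_range_le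
    _ = dimH (antiVRParameters M (Fin (p + 1)) r) := by
        rw [← isometry_subtype_coe.dimH_image, image_univ, Subtype.range_coe]
    _ ≤ dimH ((univ : Set (Fin (p + 1) → M)) ×ˢ stdSimplex ℝ (Fin (p + 1))) :=
        dimH_mono fun z hz => ⟨mem_univ _, hz.2⟩
    _ ≤ ((Module.finrank ℝ F * (p + 1) + p : ℕ) : ℝ≥0∞) := dimH_pi_prod_stdSimplex_le hM p
    _ < k := by
        -- The dimension bound is `(finrank + 1) * (p + 1) - 1`; the simplex having one dimension
        -- less than its number of vertices gives the strict inequality.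
        rw [Nat.cast_lt]
        refine lt_of_lt_of_le ?_ hk
        rw [add_mul]
        omega

theorem corollary6p2 (n : ℕ) {M : Type*} [MetricSpace M] [CompactSpace M]
    [ChartedSpace (EuclideanSpace ℝ (Fin n)) M] [IsManifold (𝓡 n) ∞ M]
    [RiemannianBundle (fun x : M => TangentSpace (𝓡 n) x)]
    [IsContMDiffRiemannianBundle (𝓡 n) ∞ (EuclideanSpace ℝ (Fin n))
      (fun x : M => TangentSpace (𝓡 n) x)]
    [IsRiemannianManifold (𝓡 n) M]
    [MeasurableSpace M] [BorelSpace M]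
    (G : Type*) [AddCommGroup G] (r : ℝ) (hr : 0 ≤ r)
    (k : ℕ) (hk : ((n : ℕ∞) + 1) * packingNumber M r ≤ (k : ℕ∞)) :
    Subsingleton (CechCohomology (AntiVRThickening M r) G k) := by
  have hM : ∀ x : M, ∃ (C : ℝ≥0) (V : Set (EuclideanSpace ℝ (Fin n)))
      (ψ : EuclideanSpace ℝ (Fin n) → M), LipschitzOnWith C ψ V ∧ ψ '' V ∈ 𝓝 x := fun x => by
    have : IsContinuousRiemannianBundle (EuclideanSpace ℝ (Fin n))
        (fun x : M => TangentSpace (𝓡 n) x) := by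
      obtain ⟨g, hg, hg'⟩ := IsContMDiffRiemannianBundle.exists_contMDiff (IB := 𝓡 n) (n := ∞)
        (F := EuclideanSpace ℝ (Fin n)) (E := fun x : M => TangentSpace (𝓡 n) x)
      exact ⟨g, hg.continuous, hg'⟩
    have : IsManifold (𝓡 n) 1 M := IsManifold.of_le (n := ∞) (by simp)
    obtain ⟨C, t, ht, -, hC⟩ := exists_lipschitzOnWith_extChartAt_symm (I := 𝓡 n) x
    -- The model has no boundary, so `t` is a full neighbourhood and its image under the inverse
    -- chart is a neighbourhood of `x`.
    rw [ModelWithCorners.range_eq_univ, nhdsWithin_univ] at ht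
    refine ⟨C, t, _, hC, ?_⟩
    filter_upwards [(continuousAt_extChartAt (I := 𝓡 n) x).preimage_mem_nhds ht,
      extChartAt_source_mem_nhds (I := 𝓡 n) x] with y hy hys
    exact ⟨_, hy, (extChartAt (𝓡 n) x).left_inv hys⟩
  -- An infinite packing number would make the lower bound on `k` infinite.
  have htop : packingNumber M r ≠ ⊤ := fun h => by
    rw [h, ENat.mul_top (by simp)] at hk
    exact ENat.natCast_ne_top k (top_le_iff.1 hk)
  obtain ⟨p, hp⟩ := ENat.ne_top_iff_exists.1 htop
  refine AntiVRThickening.subsingleton_cechCohomology hM G (p := p) (fun s hs => ?_) ?_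
  · have h1 : (s : Set M).encard ≤ packingNumber M r :=
      le_iSup₂ (f := fun (S : Set M) (_ : IsPacking r S) => S.encard) (s : Set M) hs
    rw [← hp, Set.encard_coe_eq_coe_finsetCard] at h1
    exact_mod_cast h1
  · rw [← hp] at hk
    rw [finrank_euclideanSpace_fin]
    exact_mod_cast hk
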